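/- Fix an algebraic closure $\overline{\mathbb Q}$ of $\mathbb Q$. For an elliptic curve $E/\mathbb Q$ let $\Delta_E$ be the discriminant of a Weierstrass equation over $\mathbb Q$ (well defined modulo squares), and let $\mathbb Q(E[m])$ be its $m$-division field. Let $\mathbb Q^{\rm ab}$ be the maximal abelian extension of $\mathbb Q$ in $\overline{\mathbb Q}$. For integers $0<a<b$ put $d=\gcd(a,b)$, $K_m=\mathbb Q(E[m])\cap\mathbb Q^{\rm ab}$ for $m\in\{a,b\}$. For a non-trivial finite abelian group $T$, one says that $E$ has a *Weil $(a,b)$-entanglement of type $T$* if $\mathrm{Gal}(K_a\cap\mathbb Q(\zeta_b)/\mathbb Q(\zeta_d))\cong T$ or $\mathrm{Gal}(K_b\cap\mathbb Q(\zeta_a)/\mathbb Q(\zeta_d))\cong T$. A *Serre entanglement* of $E$ is a Weil $(2,n)$-entanglement of type $\mathbb Z/2\mathbb Z$ for some integer $n>2$. Let $K\subseteq\overline{\mathbb Q}$ be a quadratic number field. Then there are infinitely many $\overline{\mathbb Q}$-isomorphism classes of elliptic curves $E/\mathbb Q$ that have a Serre entanglement and satisfy $\mathbb Q(\sqrt{\Delta_E})=K$.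 For each such curve, given by a Weierstrass equation over $\mathbb Q$ whose discriminant $\Delta_E$ is an integer, the entanglement occurs at $n=4|\Delta_E|$, that is, $E$ has a Weil $(2,4|\Delta_E|)$-entanglement of type $\mathbb Z/2\mathbb Z$. Moreover, let $d\neq 1$ be the square-free integer with $K=\mathbb Q(\sqrt d)$. An elliptic curve $E/\mathbb Q$ with $j(E)\neq1728$ has a Serre entanglement and satisfies $\mathbb Q(\sqrt{\Delta_E})=K$ if and only if $j(E)=dt^2+1728$ for some $t\in\mathbb Q^\times$. There is also at least one elliptic curve $E/\mathbb Q$ with $j(E)=1728$ that has a Serre entanglement and satisfies $\mathbb Q(\sqrt{\Delta_E})=K$. -/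

import Mathlib

namespace SerreEntanglement

/-- A fixed algebraic closure of the rational numbers. -/
abbrev Qbar : Type := AlgebraicClosure ℚ

/-- Elliptic curves over `ℚ`, given by Weierstrass equations with non-zero discriminant. -/
abbrev RatEllipticCurve : Type := {E : WeierstrassCurve ℚ // E.IsElliptic}

instance (E : RatEllipticCurve) : E.1.IsElliptic := E.2

/-- Two elliptic curves over `ℚ` are identified when they become isomorphic over `Qbar`, that is,
when an admissible change of variables over `Qbar` transforms one equation into the other. -/
noncomputable instance geometricIso : Setoid RatEllipticCurve :=
  (MulAction.orbitRel (WeierstrassCurve.VariableChange Qbar) (WeierstrassCurve Qbar)).comap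
    fun E => E.1.baseChange Qbar

/-- The set of `Qbar`-isomorphism classes of elliptic curves over `ℚ`. -/
abbrev GeometricClass : Type := Quotient geometricIso

open Classical in
/-- The division field `ℚ(E[n])`, generated by the coordinates of the affine points of
`E(Qbar)` killed by `n`. -/
noncomputable def divisionField (E : RatEllipticCurve) (n : ℕ) : IntermediateField ℚ Qbar :=
  IntermediateField.adjoin ℚ
    {z : Qbar | ∃ (x y : Qbar) (h : (E.1.baseChange Qbar).toAffine.Nonsingular x y),
      n • WeierstrassCurve.Affine.Point.some x y h = 0 ∧ (z = x ∨ z = y)}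

/-- The cyclotomic field `ℚ(ζₙ)` inside `Qbar`. -/
noncomputable def cyclotomic (n : ℕ) : IntermediateField ℚ Qbar :=
  IntermediateField.adjoin ℚ {z : Qbar | IsPrimitiveRoot z n}

/-- The maximal abelian extension `ℚ^ab` of `ℚ` inside `Qbar`: the compositum of all abelian
extensions of `ℚ`. -/
noncomputable def maxAbelian : IntermediateField ℚ Qbar :=
  sSup {F : IntermediateField ℚ Qbar | IsAbelianGalois ℚ F}

/-- The field `ℚ(√a)` inside `Qbar`. -/
noncomputable def sqrtField (a : ℚ) : IntermediateField ℚ Qbar :=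
  IntermediateField.adjoin ℚ {z : Qbar | z ^ 2 = algebraMap ℚ Qbar a}

/-- `GalIso F L T`: the field `L` contains `F`, and `Gal(L/F) ≅ T`. -/
def GalIso (F L : IntermediateField ℚ Qbar) (T : Type*) [Group T] : Prop :=
  ∃ h : F ≤ L, Nonempty
    ((IntermediateField.extendScalars h ≃ₐ[F] IntermediateField.extendScalars h) ≃* T)

/-- `E` has a Weil `(a, b)`-entanglement of type `T`, where `a < b` and `T` is a non-trivial finite
abelian group: with `K_m = ℚ(E[m]) ∩ ℚ^ab` and `d = gcd(a, b)`, the group `T` is isomorphic to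
`Gal(K_a ∩ ℚ(ζ_b) / ℚ(ζ_d))` or to `Gal(K_b ∩ ℚ(ζ_a) / ℚ(ζ_d))`. -/
def HasWeilEntanglement (E : RatEllipticCurve) (a b : ℕ)
    (T : Type*) [CommGroup T] [Finite T] [Nontrivial T] : Prop :=
  0 < a ∧ a < b ∧
    (GalIso (cyclotomic (Nat.gcd a b)) ((divisionField E a ⊓ maxAbelian) ⊓ cyclotomic b) T ∨
      GalIso (cyclotomic (Nat.gcd a b)) ((divisionField E b ⊓ maxAbelian) ⊓ cyclotomic a) T)

/-- `E` has a Serre entanglement: a Weil `(2, n)`-entanglement of type `ℤ/2ℤ` for some `n > 2`. -/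
def HasSerreEntanglement (E : RatEllipticCurve) : Prop :=
  ∃ n : ℕ, 2 < n ∧ HasWeilEntanglement E 2 n (Multiplicative (ZMod 2))

/-- The elliptic curves over `ℚ` with a Serre entanglement such that `ℚ(√Δ_E) = K`. -/
def serreCurves (K : IntermediateField ℚ Qbar) : Set RatEllipticCurve :=
  {E | HasSerreEntanglement E ∧ sqrtField E.1.Δ = K}

end SerreEntanglement

/-!
Write `√Δ` for a square root of the discriminant of `E`. If `ℚ(√Δ)` is quadratic, then for every
`n ≥ 1` the field `ℚ(E[2]) ∩ ℚ(ζₙ)` is contained in `ℚ(√Δ)`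
(`divisionField_two_inf_cyclotomic_le`): `ℚ(E[2])` is the splitting field of the 2-torsion cubic,
whose roots are permuted evenly exactly by the automorphisms that fix `√Δ`. For an even permutation
`σ` and an odd one `τ` of three letters, `σ τ = τ σ²`; since automorphisms commute on `ℚ(ζₙ)`, every
`σ` fixing `√Δ` is trivial on the intersection.

Conversely `√Δ` is a multiple of the Vandermonde determinant of the roots and so lies in `ℚ(E[2])`,
and if `D` is a non-zero integer then `√D ∈ ℚ(ζ_{4|D|})` by quadratic Gauss sums
(`sqrtField_le_cyclotomic`). Taking for `D` the product of the numerator and the denominator of `Δ`,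
or `Δ` itself if it is an integer, shows that `E` has a Serre entanglement with `ℚ(√Δ) = K` if and
only if `ℚ(√Δ) = K` (`mem_serreCurves_iff`), and that the entanglement occurs at `4|Δ|` for integral
`Δ`.

The rest is the identity `(j - 1728) Δ = c₆²`: for `j ≠ 1728` it says that `Δ` and `j - 1728`
differ by a square factor. Let `K = ℚ(√d)`. As every `j ∈ ℚ` is the invariant of some curve, the
values `d t² + 1728` give infinitely many classes, and `y² = x³ - d x` has `j = 1728` and `Δ = 64 d³`.
-/

namespace SerreEntanglement

open IntermediateField

/-! ### Automorphisms of `Qbar` and fixed elements -/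

/-- The two available `ℚ`-algebra structures on `Qbar` agree, so that facts about algebraic closures
apply to the one used for intermediate fields. -/
theorem algebraicClosure_algebra_eq :
    (AlgebraicClosure.instAlgebra ℚ : Algebra ℚ Qbar) = DivisionRing.toRatAlgebra :=
  Subsingleton.elim _ _

instance isAlgebraic_Qbar : Algebra.IsAlgebraic ℚ Qbar :=
  algebraicClosure_algebra_eq ▸ AlgebraicClosure.isAlgebraic ℚ

instance isGalois_Qbar : IsGalois ℚ Qbar where
  to_normal := ⟨fun _ => IsAlgClosed.splits _⟩

theorem apply_eq_of_mem_adjoin {S : Set Qbar} {σ τ : Qbar →ₐ[ℚ] Qbar}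
    (h : ∀ x ∈ S, σ x = τ x) {z : Qbar} (hz : z ∈ adjoin ℚ S) : σ z = τ z := by
  induction hz using adjoin_induction with
  | mem x hx => exact h x hx
  | algebraMap x => simp
  | add x y _ _ hx hy => simp [hx, hy]
  | inv x _ hx => simp [hx]
  | mul x y _ _ hx hy => simp [hx, hy]

/-- The Galois correspondence for `Qbar / ℚ`, as a membership criterion. -/
theorem mem_of_forall_fixed {F : IntermediateField ℚ Qbar} {z : Qbar}
    (h : ∀ σ : Qbar ≃ₐ[ℚ] Qbar, (∀ x ∈ F, σ x = x) → σ z = z) : z ∈ F := by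
  rw [← InfiniteGalois.fixedField_fixingSubgroup F]
  rintro ⟨σ, hσ⟩
  exact h σ fun x hx => (mem_fixingSubgroup_iff _ _).mp hσ x hx

theorem mem_bot_of_forall_fixed {z : Qbar} (h : ∀ σ : Qbar ≃ₐ[ℚ] Qbar, σ z = z) :
    z ∈ (⊥ : IntermediateField ℚ Qbar) :=
  mem_of_forall_fixed fun σ _ => h σ

/-! ### Fields generated by a square root -/

theorem sqrtField_eq_adjoin_simple {a : ℚ} {α : Qbar} (hα : α ^ 2 = algebraMap ℚ Qbar a) :
    sqrtField a = ℚ⟮α⟯ := by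
  apply le_antisymm
  · refine adjoin_le_iff.mpr fun z (hz : z ^ 2 = _) => ?_
    rcases sq_eq_sq_iff_eq_or_eq_neg.mp (hz.trans hα.symm) with rfl | rfl
    · exact mem_adjoin_simple_self ℚ z
    · exact neg_mem (mem_adjoin_simple_self ℚ α)
  · exact adjoin_simple_le_iff.mpr (subset_adjoin ℚ _ hα)

theorem exists_sqrt (a : ℚ) : ∃ α : Qbar, α ^ 2 = algebraMap ℚ Qbar a :=
  IsAlgClosed.exists_pow_nat_eq _ two_pos

theorem mem_sqrtField {a : ℚ} {α : Qbar} (hα : α ^ 2 = algebraMap ℚ Qbar a) :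
    α ∈ sqrtField a :=
  subset_adjoin ℚ _ hα

theorem apply_sqrt {a : ℚ} {α : Qbar} (hα : α ^ 2 = algebraMap ℚ Qbar a)
    (σ : Qbar ≃ₐ[ℚ] Qbar) : σ α = α ∨ σ α = -α := by
  rw [← sq_eq_sq_iff_eq_or_eq_neg, ← map_pow, hα, AlgEquiv.commutes]

theorem sqrtField_mul_sq (a : ℚ) {s : ℚ} (hs : s ≠ 0) : sqrtField (a * s ^ 2) = sqrtField a := by
  obtain ⟨α, hα⟩ := exists_sqrt a
  have hs' : algebraMap ℚ Qbar s ≠ 0 := (map_ne_zero _).mpr hs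
  have h : (α * algebraMap ℚ Qbar s) ^ 2 = algebraMap ℚ Qbar (a * s ^ 2) := by
    rw [mul_pow, hα, map_mul, map_pow]
  rw [sqrtField_eq_adjoin_simple hα, sqrtField_eq_adjoin_simple h]
  apply le_antisymm <;> rw [adjoin_simple_le_iff]
  · exact mul_mem (mem_adjoin_simple_self ℚ α) (IntermediateField.algebraMap_mem _ s)
  · have := div_mem (mem_adjoin_simple_self ℚ (α * algebraMap ℚ Qbar s))
      (IntermediateField.algebraMap_mem ℚ⟮α * algebraMap ℚ Qbar s⟯ s)
    rwa [mul_div_cancel_right₀ _ hs'] at this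

theorem sqrt_notMem_bot {a : ℚ} (h : Module.finrank ℚ (sqrtField a) = 2) {α : Qbar}
    (hα : α ^ 2 = algebraMap ℚ Qbar a) : α ∉ (⊥ : IntermediateField ℚ Qbar) := by
  intro hmem
  rw [sqrtField_eq_adjoin_simple hα, adjoin_simple_eq_bot_iff.mpr hmem,
    IntermediateField.finrank_bot] at h
  omega

theorem ne_zero_of_finrank_sqrtField {a : ℚ} (h : Module.finrank ℚ (sqrtField a) = 2) :
    a ≠ 0 := by
  rintro rfl
  exact sqrt_notMem_bot h (α := 0) (by simp) (zero_mem _)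

theorem exists_apply_sqrt_eq_neg {a : ℚ} (h : Module.finrank ℚ (sqrtField a) = 2) {α : Qbar}
    (hα : α ^ 2 = algebraMap ℚ Qbar a) : ∃ τ : Qbar ≃ₐ[ℚ] Qbar, τ α = -α := by
  by_contra! H
  exact sqrt_notMem_bot h hα
    (mem_bot_of_forall_fixed fun σ => (apply_sqrt hα σ).resolve_right (H σ))

/-- If `ℚ(√a) = ℚ(√b)` is quadratic, then every automorphism acts on `√a` and `√b` by the same
sign, so that `√a / √b` is rational. -/
theorem exists_eq_mul_sq_of_sqrtField_eq {a b : ℚ} (h : Module.finrank ℚ (sqrtField b) = 2)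
    (hab : sqrtField a = sqrtField b) : ∃ s : ℚ, s ≠ 0 ∧ a = b * s ^ 2 := by
  obtain ⟨α, hα⟩ := exists_sqrt a
  obtain ⟨β, hβ⟩ := exists_sqrt b
  have ha0 : a ≠ 0 := ne_zero_of_finrank_sqrtField (hab ▸ h)
  have hb0 : b ≠ 0 := ne_zero_of_finrank_sqrtField h
  have hβ0 : β ≠ 0 := by
    rintro rfl
    exact hb0 (by simpa using hβ.symm)
  have fix : ∀ {x y : Qbar}, y ∈ ℚ⟮x⟯ → ∀ σ : Qbar ≃ₐ[ℚ] Qbar, σ x = x → σ y = y := by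
    intro x y hy σ hσ
    exact apply_eq_of_mem_adjoin (σ := σ) (τ := AlgHom.id ℚ Qbar) (by simpa using hσ) hy
  have hαβ : α ∈ ℚ⟮β⟯ := by
    rw [← sqrtField_eq_adjoin_simple hβ, ← hab]; exact mem_sqrtField hα
  have hβα : β ∈ ℚ⟮α⟯ := by
    rw [← sqrtField_eq_adjoin_simple hα, hab]; exact mem_sqrtField hβ
  have hmem : α / β ∈ (⊥ : IntermediateField ℚ Qbar) := by
    refine mem_bot_of_forall_fixed fun σ => ?_
    rw [map_div₀]
    rcases apply_sqrt hβ σ with hσ | hσ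
    · rw [hσ, fix hαβ σ hσ]
    · rcases apply_sqrt hα σ with hσ' | hσ'
      · rw [fix hβα σ hσ', hσ']
      · rw [hσ, hσ', neg_div_neg_eq]
  obtain ⟨s, hs⟩ := mem_bot.mp hmem
  have : a = b * s ^ 2 := by
    apply (algebraMap ℚ Qbar).injective
    rw [map_mul, map_pow, hs, ← hα, ← hβ, div_pow]
    field_simp
  refine ⟨s, ?_, this⟩
  rintro rfl
  exact ha0 (by simpa using this)

theorem exists_int_mul_sq (q : ℚ) : ∃ (m : ℤ) (s : ℚ), s ≠ 0 ∧ q = m * s ^ 2 := by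
  have hd : (q.den : ℚ) ≠ 0 := by exact_mod_cast q.den_ne_zero
  refine ⟨q.num * q.den, (q.den : ℚ)⁻¹, inv_ne_zero hd, ?_⟩
  push_cast
  field_simp
  exact q.mul_den_eq_num

/-- Every non-zero rational number is a square-free integer times a square. -/
theorem exists_squarefree_mul_sq {q : ℚ} (hq : q ≠ 0) :
    ∃ (d : ℤ) (s : ℚ), Squarefree d ∧ s ≠ 0 ∧ q = d * s ^ 2 := by
  obtain ⟨m, s, hs, rfl⟩ := exists_int_mul_sq q
  have hm : m ≠ 0 := by
    rintro rfl
    simp at hq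
  obtain ⟨a, b, hab, ha⟩ := Nat.sq_mul_squarefree m.natAbs
  have hb : b ≠ 0 := by
    rintro rfl
    simp at hab
    omega
  refine ⟨m.sign * a, b * s, ?_, mul_ne_zero (by exact_mod_cast hb) hs, ?_⟩
  · rw [← Int.squarefree_natAbs, Int.natAbs_mul, Int.natAbs_sign_of_ne_zero hm]
    simpa using ha
  · have : m = m.sign * (b ^ 2 * a : ℕ) := by rw [hab, Int.sign_mul_natAbs]
    conv_lhs => rw [this]
    push_cast
    ring

theorem exists_sqrtField_eq_of_finrank_eq_two {K : IntermediateField ℚ Qbar}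
    (hK : Module.finrank ℚ K = 2) :
    ∃ d : ℤ, Squarefree d ∧ d ≠ 1 ∧ K = sqrtField (d : ℚ) := by
  have : FiniteDimensional ℚ K := FiniteDimensional.of_finrank_pos (by omega)
  have hbot : K ≠ ⊥ := by
    rintro rfl
    rw [IntermediateField.finrank_bot] at hK
    omega
  obtain ⟨α, hαK, hα⟩ := SetLike.exists_of_lt (bot_lt_iff_ne_bot.mpr hbot)
  have eq_adj : ∀ β ∈ K, β ∉ (⊥ : IntermediateField ℚ Qbar) → ℚ⟮β⟯ = K := by
    intro β hβK hβ
    have hle : ℚ⟮β⟯ ≤ K := adjoin_simple_le_iff.mpr hβK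
    refine eq_of_le_of_finrank_le hle ?_
    have h1 : Module.finrank ℚ ℚ⟮β⟯ ≠ 1 := by
      rwa [Ne, IntermediateField.finrank_eq_one_iff, adjoin_simple_eq_bot_iff]
    have : FiniteDimensional ℚ ℚ⟮β⟯ :=
      adjoin.finiteDimensional (Algebra.IsIntegral.isIntegral β)
    have : 0 < Module.finrank ℚ ℚ⟮β⟯ := Module.finrank_pos
    omega
  have hdeg : (minpoly ℚ α).natDegree = 2 := by
    rw [← adjoin.finrank (Algebra.IsIntegral.isIntegral α), eq_adj α hαK hα, hK]
  have hmonic := minpoly.monic (Algebra.IsIntegral.isIntegral (R := ℚ) α)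
  set b := (minpoly ℚ α).coeff 1
  set c := (minpoly ℚ α).coeff 0
  have hrel : α ^ 2 + algebraMap ℚ Qbar b * α + algebraMap ℚ Qbar c = 0 := by
    have h0 := minpoly.aeval ℚ α
    have h2 : (minpoly ℚ α).coeff 2 = 1 := by rw [← hdeg]; exact hmonic.coeff_natDegree
    rw [Polynomial.aeval_eq_sum_range, hdeg] at h0
    simp only [Finset.sum_range_succ, Finset.sum_range_zero, h2, Algebra.smul_def] at h0
    rw [map_one] at h0
    linear_combination h0
  -- Completing the square moves the generator `α` to a square root of a rational number.
  set β : Qbar := α + algebraMap ℚ Qbar (b / 2) with hβdef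
  have hβsq : β ^ 2 = algebraMap ℚ Qbar (b ^ 2 / 4 - c) := by
    simp only [hβdef, map_sub, map_div₀, map_pow, map_ofNat]
    linear_combination hrel
  have hβ : β ∉ (⊥ : IntermediateField ℚ Qbar) := by
    intro h
    apply hα
    simpa [hβdef] using sub_mem h (IntermediateField.algebraMap_mem _ (b / 2))
  have hKq : K = sqrtField (b ^ 2 / 4 - c) := by
    rw [sqrtField_eq_adjoin_simple hβsq,
      eq_adj β (add_mem hαK (IntermediateField.algebraMap_mem _ _)) hβ]
  rw [hKq] at hK
  obtain ⟨d, s, hd, hs, hq⟩ := exists_squarefree_mul_sq (ne_zero_of_finrank_sqrtField hK)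
  rw [hq, sqrtField_mul_sq _ hs] at hK hKq
  refine ⟨d, hd, ?_, hKq⟩
  rintro rfl
  exact sqrt_notMem_bot hK (α := 1) (by simp) (one_mem _)

/-! ### Square roots of integers in cyclotomic fields -/

theorem exists_primitiveRoot {n : ℕ} (hn : n ≠ 0) : ∃ ζ : Qbar, IsPrimitiveRoot ζ n := by
  have : NeZero (n : Qbar) := ⟨by exact_mod_cast hn⟩
  exact HasEnoughRootsOfUnity.exists_primitiveRoot Qbar n

theorem mem_cyclotomic {n : ℕ} {ζ : Qbar} (hζ : IsPrimitiveRoot ζ n) : ζ ∈ cyclotomic n :=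
  subset_adjoin ℚ _ hζ

theorem cyclotomic_eq_adjoin_simple {n : ℕ} (hn : n ≠ 0) {ζ : Qbar} (hζ : IsPrimitiveRoot ζ n) :
    cyclotomic n = ℚ⟮ζ⟯ := by
  have : NeZero n := ⟨hn⟩
  apply le_antisymm
  · refine adjoin_le_iff.mpr fun z (hz : IsPrimitiveRoot z n) => ?_
    obtain ⟨i, -, rfl⟩ := hζ.eq_pow_of_pow_eq_one hz.pow_eq_one
    exact pow_mem (mem_adjoin_simple_self ℚ ζ) i
  · exact adjoin_simple_le_iff.mpr (mem_cyclotomic hζ)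

theorem cyclotomic_mono {m n : ℕ} (hmn : m ∣ n) (hn : n ≠ 0) : cyclotomic m ≤ cyclotomic n := by
  obtain ⟨k, rfl⟩ := hmn
  obtain ⟨ζ, hζ⟩ := exists_primitiveRoot hn
  rw [cyclotomic_eq_adjoin_simple (left_ne_zero_of_mul hn)
    (hζ.pow (Nat.pos_of_ne_zero hn) (mul_comm m k)), adjoin_simple_le_iff]
  exact pow_mem (mem_cyclotomic hζ) _

theorem cyclotomic_eq_bot {n : ℕ} (hn : n ∣ 2) : cyclotomic n = ⊥ := by
  refine eq_bot_iff.mpr (adjoin_le_iff.mpr fun z (hz : IsPrimitiveRoot z n) => ?_)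
  have : z ^ 2 = 1 := by
    obtain ⟨k, hk⟩ := hn
    rw [hk, pow_mul, hz.pow_eq_one, one_pow]
  rcases sq_eq_sq_iff_eq_or_eq_neg.mp (this.trans (one_pow 2).symm) with rfl | rfl
  · exact one_mem _
  · exact neg_mem (one_mem _)

theorem isAbelianGalois_cyclotomic (n : ℕ) (hn : n ≠ 0) : IsAbelianGalois ℚ (cyclotomic n) := by
  have : NeZero n := ⟨hn⟩
  obtain ⟨ζ, hζ⟩ := exists_primitiveRoot hn
  rw [cyclotomic_eq_adjoin_simple hn hζ]
  exact @IsCyclotomicExtension.isAbelianGalois {n} ℚ _ _ _ _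
    (hζ.intermediateField_adjoin_isCyclotomicExtension ℚ)

/-- Automorphisms raise roots of unity to powers, and so commute on cyclotomic fields. -/
theorem apply_comm_of_mem_cyclotomic {n : ℕ} (hn : n ≠ 0) (σ τ : Qbar ≃ₐ[ℚ] Qbar) {z : Qbar}
    (hz : z ∈ cyclotomic n) : σ (τ z) = τ (σ z) := by
  have : NeZero n := ⟨hn⟩
  refine apply_eq_of_mem_adjoin (σ := (σ : Qbar →ₐ[ℚ] Qbar).comp τ)
    (τ := (τ : Qbar →ₐ[ℚ] Qbar).comp σ) (fun ζ (hζ : IsPrimitiveRoot ζ n) => ?_) hz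
  obtain ⟨i, -, hi⟩ := hζ.eq_pow_of_pow_eq_one (ξ := σ ζ)
    (by rw [← map_pow, hζ.pow_eq_one, map_one])
  obtain ⟨j, -, hj⟩ := hζ.eq_pow_of_pow_eq_one (ξ := τ ζ)
    (by rw [← map_pow, hζ.pow_eq_one, map_one])
  simp [← hi, ← hj, ← pow_mul, mul_comm]

theorem mem_of_sq_eq_sq {F : IntermediateField ℚ Qbar} {z w : Qbar} (hw : w ∈ F)
    (h : z ^ 2 = w ^ 2) : z ∈ F := by
  rcases sq_eq_sq_iff_eq_or_eq_neg.mp h with rfl | rfl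
  · exact hw
  · exact neg_mem hw

theorem exists_sq_eq_neg_one_mem_cyclotomic_four : ∃ i ∈ cyclotomic 4, i ^ 2 = -1 := by
  obtain ⟨i, hi⟩ := exists_primitiveRoot (n := 4) (by norm_num)
  refine ⟨i, mem_cyclotomic hi, ?_⟩
  exact (hi.pow (by norm_num) (by norm_num : 4 = 2 * 2)).eq_neg_one_of_two_right

theorem exists_sq_eq_two_mem_cyclotomic_eight : ∃ w ∈ cyclotomic 8, w ^ 2 = 2 := by
  obtain ⟨ζ, hζ⟩ := exists_primitiveRoot (n := 8) (by norm_num)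
  have h4 : ζ ^ 4 = -1 :=
    (hζ.pow (by norm_num) (by norm_num : 8 = 4 * 2)).eq_neg_one_of_two_right
  have h0 : ζ ≠ 0 := hζ.ne_zero (by norm_num)
  refine ⟨ζ + ζ⁻¹, add_mem (mem_cyclotomic hζ) (inv_mem (mem_cyclotomic hζ)), ?_⟩
  field_simp
  linear_combination h4

/-- The quadratic Gauss sum is a square root of `±p` in `ℚ(ζ_p)`. -/
theorem exists_sq_eq_prime_mem_cyclotomic {p : ℕ} (hp : p.Prime) (hp2 : p ≠ 2) :
    ∃ g ∈ cyclotomic p, g ^ 2 = p ∨ g ^ 2 = -p := by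
  have : Fact p.Prime := ⟨hp⟩
  obtain ⟨ζ, hζ⟩ := exists_primitiveRoot hp.ne_zero
  let ψ := AddChar.zmodChar p hζ.pow_eq_one
  have hψ : ψ.IsPrimitive := AddChar.zmodChar_primitive_of_primitive_root p hζ
  have hchar : ringChar (ZMod p) ≠ 2 := by rwa [ZMod.ringChar_zmod_n]
  let χ := (quadraticChar (ZMod p)).ringHomComp (Int.castRingHom Qbar)
  have hχ : χ.IsQuadratic := (quadraticChar_isQuadratic (ZMod p)).comp _
  have hχ1 : χ ≠ 1 :=
    (MulChar.ringHomComp_ne_one_iff (RingHom.injective_int _)).mpr (quadraticChar_ne_one hchar)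
  have hsq := gaussSum_sq hχ1 hχ hψ
  rw [ZMod.card] at hsq
  refine ⟨gaussSum χ ψ, sum_mem fun a _ => mul_mem ?_ ?_, ?_⟩
  · exact intCast_mem _ _
  · exact pow_mem (mem_cyclotomic hζ) _
  · rcases hχ (-1) with h | h | h
    · exact absurd h ((isUnit_neg_one.map χ).ne_zero)
    · left; rw [hsq, h, one_mul]
    · right; rw [hsq, h, neg_one_mul]

/-- By multiplicativity the statement reduces to primes, where it follows from Gauss sums, from
`i ∈ ℚ(ζ₄)` and from `√2 ∈ ℚ(ζ₈)`; the factor `4` is there to supply these. -/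
theorem exists_sq_eq_natCast_mem_cyclotomic (m : ℕ) (hm : m ≠ 0) :
    ∃ w ∈ cyclotomic (4 * m), w ^ 2 = m := by
  obtain ⟨i, hi, hisq⟩ := exists_sq_eq_neg_one_mem_cyclotomic_four
  induction m using Nat.recOnMul with
  | zero => exact absurd rfl hm
  | one => exact ⟨1, one_mem _, by simp⟩
  | prime p hp =>
    rcases eq_or_ne p 2 with rfl | hp2
    · simpa using exists_sq_eq_two_mem_cyclotomic_eight
    · have h0 : 4 * p ≠ 0 := mul_ne_zero (by norm_num) hp.ne_zero
      obtain ⟨g, hg, hgsq⟩ := exists_sq_eq_prime_mem_cyclotomic hp hp2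
      have hg' := cyclotomic_mono (Dvd.intro_left 4 rfl) h0 hg
      rcases hgsq with h | h
      · exact ⟨g, hg', h⟩
      · exact ⟨i * g, mul_mem (cyclotomic_mono (Dvd.intro p rfl) h0 hi) hg',
          by rw [mul_pow, hisq, h]; ring⟩
  | mul a b iha ihb =>
    have ha := left_ne_zero_of_mul hm
    have hb := right_ne_zero_of_mul hm
    obtain ⟨u, hu, husq⟩ := iha ha
    obtain ⟨v, hv, hvsq⟩ := ihb hb
    have h0 : 4 * (a * b) ≠ 0 := mul_ne_zero (by norm_num) hm
    refine ⟨u * v, mul_mem (cyclotomic_mono ?_ h0 hu) (cyclotomic_mono ?_ h0 hv), ?_⟩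
    · exact mul_dvd_mul_left 4 (Dvd.intro b rfl)
    · exact mul_dvd_mul_left 4 (Dvd.intro_left a rfl)
    · rw [mul_pow, husq, hvsq, Nat.cast_mul]

theorem sqrtField_le_cyclotomic {D : ℤ} (hD : D ≠ 0) :
    sqrtField (D : ℚ) ≤ cyclotomic (4 * D.natAbs) := by
  have h0 : 4 * D.natAbs ≠ 0 := by omega
  obtain ⟨w, hw, hwsq⟩ := exists_sq_eq_natCast_mem_cyclotomic D.natAbs (by omega)
  obtain ⟨i, hi, hisq⟩ := exists_sq_eq_neg_one_mem_cyclotomic_four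
  refine adjoin_le_iff.mpr fun z (hz : z ^ 2 = _) => ?_
  have hz' : z ^ 2 = ((D : ℤ) : Qbar) := by simpa using hz
  rcases Int.natAbs_eq D with h | h
  · refine mem_of_sq_eq_sq hw ?_
    rw [hz', h, hwsq]
    simp
  · refine mem_of_sq_eq_sq (mul_mem (cyclotomic_mono (Dvd.intro _ rfl) h0 hi) hw) ?_
    rw [hz', mul_pow, hisq, hwsq]
    conv_lhs => rw [h]
    simp

theorem cyclotomic_le_maxAbelian {n : ℕ} (hn : n ≠ 0) : cyclotomic n ≤ maxAbelian :=
  le_sSup (isAbelianGalois_cyclotomic n hn)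

/-! ### The 2-division field -/

/-- An affine point is killed by `2` if and only if `2y + a₁x + a₃ = 0`, so `ℚ(E[2])` is generated by
the roots of the 2-torsion polynomial; the `y`-coordinates add nothing. -/
theorem divisionField_two_eq (E : RatEllipticCurve) :
    divisionField E 2 = adjoin ℚ
      {x : Qbar | 4 * x ^ 3 + algebraMap ℚ Qbar E.1.b₂ * x ^ 2 +
        2 * algebraMap ℚ Qbar E.1.b₄ * x + algebraMap ℚ Qbar E.1.b₆ = 0} := by
  classical
  set W := E.1.baseChange Qbar
  have hb₂ : W.b₂ = algebraMap ℚ Qbar E.1.b₂ := E.1.map_b₂ _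
  have hb₄ : W.b₄ = algebraMap ℚ Qbar E.1.b₄ := E.1.map_b₄ _
  have hb₆ : W.b₆ = algebraMap ℚ Qbar E.1.b₆ := E.1.map_b₆ _
  have ha₁ : W.a₁ = algebraMap ℚ Qbar E.1.a₁ := rfl
  have ha₃ : W.a₃ = algebraMap ℚ Qbar E.1.a₃ := rfl
  have two_nsmul_iff : ∀ (x y : Qbar) (h : W.toAffine.Nonsingular x y),
      2 • WeierstrassCurve.Affine.Point.some x y h = 0 ↔ 2 * y + W.a₁ * x + W.a₃ = 0 := by
    intro x y h
    rw [two_nsmul]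
    constructor
    · intro h2
      by_contra hne
      rw [WeierstrassCurve.Affine.Point.add_self_of_Y_ne] at h2
      · exact WeierstrassCurve.Affine.Point.some_ne_zero _ h2
      · intro hy
        rw [WeierstrassCurve.Affine.negY] at hy
        exact hne (by linear_combination hy)
    · intro hy
      apply WeierstrassCurve.Affine.Point.add_self_of_Y_eq
      rw [WeierstrassCurve.Affine.negY]
      linear_combination hy
  -- Completing the square: `(2y + a₁x + a₃)² = 4x³ + b₂x² + 2b₄x + b₆` on the curve.
  have key : ∀ x y : Qbar, W.toAffine.Equation x y ↔ (2 * y + W.a₁ * x + W.a₃) ^ 2 =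
      4 * x ^ 3 + W.b₂ * x ^ 2 + 2 * W.b₄ * x + W.b₆ := by
    intro x y
    rw [WeierstrassCurve.Affine.equation_iff, WeierstrassCurve.b₂, WeierstrassCurve.b₄,
      WeierstrassCurve.b₆]
    constructor
    · intro h; linear_combination 4 * h
    · intro h; linear_combination h / 4
  rw [← hb₂, ← hb₄, ← hb₆]
  apply le_antisymm
  · refine adjoin_le_iff.mpr ?_
    rintro z ⟨x, y, h, h2, hz⟩
    have hy := (two_nsmul_iff x y h).mp h2
    have hx : x ∈ adjoin ℚ {x : Qbar | 4 * x ^ 3 + W.b₂ * x ^ 2 + 2 * W.b₄ * x + W.b₆ = 0} := by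
      apply subset_adjoin
      have := (key x y).mp h.1
      rw [hy] at this
      simpa using this.symm
    rcases hz with rfl | rfl
    · exact hx
    · have : z = -(algebraMap ℚ Qbar E.1.a₁ * x + algebraMap ℚ Qbar E.1.a₃) / 2 := by
        rw [← ha₁, ← ha₃]
        linear_combination hy / 2
      rw [this]
      exact div_mem (neg_mem (add_mem (mul_mem (IntermediateField.algebraMap_mem _ _) hx)
        (IntermediateField.algebraMap_mem _ _)))
        (ofNat_mem _ 2)
  · refine adjoin_le_iff.mpr fun x hx => ?_
    have hy : 2 * (-(W.a₁ * x + W.a₃) / 2) + W.a₁ * x + W.a₃ = 0 := by ring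
    have heq : W.toAffine.Equation x (-(W.a₁ * x + W.a₃) / 2) := by
      rw [key, hy, hx.out]
      ring
    have : W.IsElliptic := inferInstanceAs (E.1.map (algebraMap ℚ Qbar)).IsElliptic
    have hns : W.toAffine.Nonsingular x (-(W.a₁ * x + W.a₃) / 2) :=
      (WeierstrassCurve.Affine.equation_iff_nonsingular (W := W)).mp heq
    exact subset_adjoin ℚ _ ⟨x, _, hns, (two_nsmul_iff _ _ hns).mpr hy, Or.inl rfl⟩

/-- The `x`-coordinates `e 0, e 1, e 2` of the points of order two generate the 2-division field,
and four times their Vandermonde determinant is a square root of the discriminant. -/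
theorem exists_roots (E : RatEllipticCurve) : ∃ e : Fin 3 → Qbar,
    Function.Injective e ∧ divisionField E 2 = adjoin ℚ (Set.range e) ∧
    (∀ (σ : Qbar ≃ₐ[ℚ] Qbar) (i : Fin 3), ∃ j, σ (e i) = e j) ∧
    (4 * (Matrix.vandermonde e).det) ^ 2 = algebraMap ℚ Qbar E.1.Δ := by
  let P := E.1.twoTorsionPolynomial
  have ha : P.a ≠ 0 := by
    change (4 : ℚ) ≠ 0
    norm_num
  obtain ⟨x, y, z, h3⟩ := (Cubic.splits_iff_roots_eq_three (φ := algebraMap ℚ Qbar) ha).mp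
    (IsAlgClosed.splits _)
  have hdisc := Cubic.discr_eq_prod_three_roots ha h3
  have hne := (Cubic.discr_ne_zero_iff_roots_ne ha h3).mp
    (E.1.twoTorsionPolynomial_discr_ne_zero_of_isElliptic (by norm_num))
  have hroots : ∀ w : Qbar, (4 * w ^ 3 + algebraMap ℚ Qbar E.1.b₂ * w ^ 2 +
      2 * algebraMap ℚ Qbar E.1.b₄ * w + algebraMap ℚ Qbar E.1.b₆ = 0) ↔
        w = x ∨ w = y ∨ w = z := by
    intro w
    have : w ∈ (Cubic.map (algebraMap ℚ Qbar) P).roots ↔ w = x ∨ w = y ∨ w = z := by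
      rw [h3]; simp
    rw [← this, Cubic.mem_roots_iff]
    · simp [Cubic.map, P, WeierstrassCurve.twoTorsionPolynomial]
    · exact Cubic.ne_zero_of_a_ne_zero (by simpa [Cubic.map] using ha)
  have hrange : ∀ w : Qbar, (4 * w ^ 3 + algebraMap ℚ Qbar E.1.b₂ * w ^ 2 +
      2 * algebraMap ℚ Qbar E.1.b₄ * w + algebraMap ℚ Qbar E.1.b₆ = 0) ↔
        w ∈ Set.range ![x, y, z] := by
    intro w
    rw [hroots]
    simp only [Set.mem_range, Fin.exists_fin_succ, eq_comm (b := w)]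
    simp
  refine ⟨![x, y, z], ?_, ?_, fun σ i => ?_, ?_⟩
  · obtain ⟨hxy, hxz, hyz⟩ := hne
    intro i j
    fin_cases i <;> fin_cases j <;> simp [hxy, hxz, hyz, hxy.symm, hxz.symm, hyz.symm]
  · rw [divisionField_two_eq]
    congr 1
    ext w
    exact hrange w
  · have hi := (hrange _).mpr (Set.mem_range_self (f := ![x, y, z]) i)
    have := congrArg σ hi
    simp only [map_add, map_mul, map_pow, AlgEquiv.commutes, map_ofNat, map_zero] at this
    obtain ⟨j, hj⟩ := (hrange _).mp this
    exact ⟨j, hj.symm⟩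
  · rw [WeierstrassCurve.twoTorsionPolynomial_discr] at hdisc
    have h4 : algebraMap ℚ Qbar P.a = 4 := map_ofNat _ 4
    rw [h4, map_mul, map_ofNat] at hdisc
    have hV : (Matrix.vandermonde ![x, y, z]).det = (y - x) * (z - x) * (z - y) := by
      rw [Matrix.det_fin_three]
      simp [Matrix.vandermonde]
      ring
    rw [hV]
    linear_combination -hdisc / 16

theorem exists_perm {e : Fin 3 → Qbar} (he : Function.Injective e)
    (σ : Qbar ≃ₐ[ℚ] Qbar) (hσ : ∀ i, ∃ j, σ (e i) = e j) :
    ∃ p : Equiv.Perm (Fin 3), (∀ i, σ (e i) = e (p i)) ∧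
      σ (Matrix.vandermonde e).det = Equiv.Perm.sign p * (Matrix.vandermonde e).det := by
  choose f hf using hσ
  have hinj : Function.Injective f := fun i j hij =>
    he (σ.injective (by rw [hf, hf, hij]))
  refine ⟨Equiv.ofBijective f (Finite.injective_iff_bijective.mp hinj), hf, ?_⟩
  rw [← Matrix.det_permute, AlgEquiv.map_det]
  congr 1
  ext i j
  simp [Matrix.vandermonde, hf]

theorem perm_three_mul_eq : ∀ p q : Equiv.Perm (Fin 3), p.sign = 1 → q.sign = -1 →
    p * q = q * (p * p) := by
  decide

/-- The part of the 2-division field inside a cyclotomic field is contained in `ℚ(√Δ)` if the latter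
is quadratic: an automorphism `σ` fixing `√Δ` permutes the points of order two evenly, so
`σ τ = τ σ²` on `ℚ(E[2])` for every `τ` that permutes them oddly. Where `σ` and `τ` commute, `σ` is
trivial. -/
theorem divisionField_two_inf_cyclotomic_le (E : RatEllipticCurve)
    (hΔ : Module.finrank ℚ (sqrtField E.1.Δ) = 2) {n : ℕ} (hn : n ≠ 0) :
    divisionField E 2 ⊓ cyclotomic n ≤ sqrtField E.1.Δ := by
  obtain ⟨e, he, hdiv, hperm, hsq⟩ := exists_roots E
  set V := (Matrix.vandermonde e).det
  have hV : V ≠ 0 := Matrix.det_vandermonde_ne_zero_iff.mpr he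
  rintro z ⟨hz, hzn⟩
  rw [SetLike.mem_coe, hdiv] at hz
  refine mem_of_forall_fixed fun σ hσ => ?_
  obtain ⟨τ, hτ⟩ := exists_apply_sqrt_eq_neg hΔ hsq
  obtain ⟨p, hp, hpV⟩ := exists_perm he σ (hperm σ)
  obtain ⟨q, hq, hqV⟩ := exists_perm he τ (hperm τ)
  have hpsign : p.sign = 1 := by
    rcases Int.units_eq_one_or p.sign with h | h
    · exact h
    · have h1 := hσ _ (mem_sqrtField hsq)
      rw [map_mul, map_ofNat, hpV, h] at h1
      have : V = 0 := by
        push_cast at h1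
        linear_combination -h1 / 8
      exact absurd this hV
  have hqsign : q.sign = -1 := by
    rcases Int.units_eq_one_or q.sign with h | h
    · rw [map_mul, map_ofNat, hqV, h] at hτ
      have : V = 0 := by
        push_cast at hτ
        linear_combination hτ / 8
      exact absurd this hV
    · exact h
  have hpq := perm_three_mul_eq p q hpsign hqsign
  have h1 : σ (τ z) = τ (σ (σ z)) := by
    refine apply_eq_of_mem_adjoin (σ := (σ : Qbar →ₐ[ℚ] Qbar).comp τ)
      (τ := (τ : Qbar →ₐ[ℚ] Qbar).comp ((σ : Qbar →ₐ[ℚ] Qbar).comp σ)) ?_ hz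
    rintro _ ⟨i, rfl⟩
    have := congrArg e (Equiv.ext_iff.mp hpq i)
    simpa [hp, hq] using this
  have h2 : σ (τ z) = τ (σ z) := apply_comm_of_mem_cyclotomic hn σ τ hzn
  exact (σ.injective (τ.injective (h2.symm.trans h1))).symm

theorem sqrtField_le_divisionField_two (E : RatEllipticCurve) :
    sqrtField E.1.Δ ≤ divisionField E 2 := by
  obtain ⟨e, -, hdiv, -, hsq⟩ := exists_roots E
  rw [sqrtField_eq_adjoin_simple hsq, adjoin_simple_le_iff, hdiv, Matrix.det_vandermonde]
  have hmem : ∀ i, e i ∈ adjoin ℚ (Set.range e) := fun i => subset_adjoin ℚ _ ⟨i, rfl⟩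
  exact mul_mem (ofNat_mem _ 4)
    (prod_mem fun i _ => prod_mem fun j _ => sub_mem (hmem j) (hmem i))

/-! ### The entanglement -/

/-- A quadratic field is Galois over `ℚ`, with group of prime order two. -/
theorem galIso_bot_of_finrank_eq_two {L : IntermediateField ℚ Qbar}
    (hL : Module.finrank ℚ L = 2) : GalIso ⊥ L (Multiplicative (ZMod 2)) := by
  refine ⟨bot_le, ?_⟩
  set M := extendScalars (bot_le : ⊥ ≤ L)
  have hM : Module.finrank (⊥ : IntermediateField ℚ Qbar) M = 2 := by
    have h := Module.finrank_mul_finrank ℚ (⊥ : IntermediateField ℚ Qbar) M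
    rw [IntermediateField.finrank_bot, one_mul] at h
    rw [h]
    exact hL
  have : Algebra.IsQuadraticExtension (⊥ : IntermediateField ℚ Qbar) M := ⟨hM⟩
  have : Fact (Nat.Prime 2) := ⟨Nat.prime_two⟩
  have : FiniteDimensional (⊥ : IntermediateField ℚ Qbar) M :=
    FiniteDimensional.of_finrank_pos (by omega)
  exact ⟨mulEquivOfPrimeCardEq (p := 2) ((IsGalois.card_aut_eq_finrank _ _).trans hM) (by simp)⟩

theorem hasWeilEntanglement_of_sqrtField_eq (E : RatEllipticCurve)
    (hΔ : Module.finrank ℚ (sqrtField E.1.Δ) = 2) {D : ℤ}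
    (hD : sqrtField (D : ℚ) = sqrtField E.1.Δ) :
    HasWeilEntanglement E 2 (4 * D.natAbs) (Multiplicative (ZMod 2)) := by
  have hD0 : D ≠ 0 := by
    have := ne_zero_of_finrank_sqrtField (hD ▸ hΔ)
    exact_mod_cast this
  have hn : 4 * D.natAbs ≠ 0 := by omega
  refine ⟨two_pos, by omega, Or.inl ?_⟩
  have hcyc : sqrtField E.1.Δ ≤ cyclotomic (4 * D.natAbs) := hD ▸ sqrtField_le_cyclotomic hD0
  have hL : (divisionField E 2 ⊓ maxAbelian) ⊓ cyclotomic (4 * D.natAbs) = sqrtField E.1.Δ := by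
    apply le_antisymm
    · exact (inf_le_inf_right _ inf_le_left).trans (divisionField_two_inf_cyclotomic_le E hΔ hn)
    · exact le_inf (le_inf (sqrtField_le_divisionField_two E)
        (hcyc.trans (cyclotomic_le_maxAbelian hn))) hcyc
  rw [hL, cyclotomic_eq_bot (Nat.gcd_dvd_left 2 _)]
  exact galIso_bot_of_finrank_eq_two hΔ

/-- Every curve with quadratic `ℚ(√Δ)` has a Serre entanglement, because `ℚ(√Δ)` is generated by the
square root of an integer and hence lies in a cyclotomic field. -/
theorem mem_serreCurves_iff {K : IntermediateField ℚ Qbar} (hK : Module.finrank ℚ K = 2)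
    (E : RatEllipticCurve) : E ∈ serreCurves K ↔ sqrtField E.1.Δ = K := by
  refine ⟨fun h => h.2, fun h => ⟨?_, h⟩⟩
  obtain ⟨D, s, hs, hq⟩ := exists_int_mul_sq E.1.Δ
  have := hasWeilEntanglement_of_sqrtField_eq E (h ▸ hK) (D := D)
    (by rw [hq, sqrtField_mul_sq _ hs])
  exact ⟨_, this.2.1, this⟩

/-! ### The `j`-invariant -/

theorem j_mul_Δ (E : RatEllipticCurve) : (E.1.j - 1728) * E.1.Δ = E.1.c₆ ^ 2 := by
  have h : E.1.j * E.1.Δ = E.1.c₄ ^ 3 := by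
    rw [WeierstrassCurve.j, ← WeierstrassCurve.coe_Δ', mul_right_comm, Units.inv_mul, one_mul]
  linear_combination h - E.1.c_relation

theorem sqrtField_Δ_eq_iff_j (E : RatEllipticCurve) (hj : E.1.j ≠ 1728) {d : ℚ}
    (hd : Module.finrank ℚ (sqrtField d) = 2) :
    sqrtField E.1.Δ = sqrtField d ↔ ∃ t : ℚ, t ≠ 0 ∧ E.1.j = d * t ^ 2 + 1728 := by
  have hΔ : E.1.Δ ≠ 0 := E.1.isUnit_Δ.ne_zero
  have hrel := j_mul_Δ E
  have hc₆ : E.1.c₆ ≠ 0 := by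
    intro h
    rw [h] at hrel
    simp [sub_eq_zero, hj, hΔ] at hrel
  have hd0 := ne_zero_of_finrank_sqrtField hd
  constructor
  · intro h
    obtain ⟨s, hs, hΔs⟩ := exists_eq_mul_sq_of_sqrtField_eq hd h
    refine ⟨E.1.c₆ / (d * s), div_ne_zero hc₆ (mul_ne_zero hd0 hs), ?_⟩
    rw [hΔs] at hrel
    field_simp
    linear_combination hrel
  · rintro ⟨t, ht, hjt⟩
    have : E.1.Δ = d * (E.1.c₆ / (d * t)) ^ 2 := by
      rw [hjt] at hrel
      field_simp
      linear_combination hrel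
    rw [this, sqrtField_mul_sq _ (div_ne_zero hc₆ (mul_ne_zero hd0 ht))]

theorem j_eq_of_geometricIso {E E' : RatEllipticCurve} (h : E ≈ E') : E.1.j = E'.1.j := by
  obtain ⟨C, hC⟩ := h
  have hC : C • E'.1.map (algebraMap ℚ Qbar) = E.1.map (algebraMap ℚ Qbar) := hC
  apply (algebraMap ℚ Qbar).injective
  rw [← WeierstrassCurve.map_j, ← WeierstrassCurve.map_j,
    ← WeierstrassCurve.variableChange_j (E'.1.map (algebraMap ℚ Qbar)) C]
  congr 1
  exact hC.symm

theorem exists_j_eq (j : ℚ) : ∃ E : RatEllipticCurve, E.1.j = j :=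
  ⟨⟨WeierstrassCurve.ofJ j, inferInstance⟩, WeierstrassCurve.ofJ_j j⟩

theorem infinite_image_serreCurves {K : IntermediateField ℚ Qbar} (hK : Module.finrank ℚ K = 2)
    {d : ℚ} (hd : K = sqrtField d) :
    ((fun E => (⟦E⟧ : GeometricClass)) '' serreCurves K).Infinite := by
  have hd0 : d ≠ 0 := ne_zero_of_finrank_sqrtField (hd ▸ hK)
  choose E hE using fun n : ℕ => exists_j_eq (d * (n + 1 : ℚ) ^ 2 + 1728)
  refine Set.infinite_of_injective_forall_mem (f := fun n => (⟦E n⟧ : GeometricClass)) ?_ ?_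
  · intro m n hmn
    have hj := j_eq_of_geometricIso (Quotient.exact hmn)
    rw [hE, hE] at hj
    have hsq : (m + 1 : ℚ) ^ 2 = (n + 1 : ℚ) ^ 2 := mul_left_cancel₀ hd0 (by linarith)
    have := (sq_eq_sq₀ (by positivity) (by positivity)).mp hsq
    exact_mod_cast add_right_cancel this
  · intro n
    have hn : (n + 1 : ℚ) ≠ 0 := by positivity
    refine ⟨E n, (mem_serreCurves_iff hK _).mpr ?_, rfl⟩
    rw [hd, sqrtField_Δ_eq_iff_j _ _ (hd ▸ hK)]
    · exact ⟨n + 1, hn, hE n⟩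
    · rw [hE]
      simpa using ⟨hd0, hn⟩

/-- The curve `y² = x³ - dx` has discriminant `64 d³` and `j`-invariant `1728`. -/
theorem exists_j_eq_1728 {d : ℚ} (hd : d ≠ 0) :
    ∃ E : RatEllipticCurve, E.1.j = 1728 ∧ sqrtField E.1.Δ = sqrtField d := by
  let W : WeierstrassCurve ℚ := ⟨0, 0, 0, -d, 0⟩
  have hW : W.Δ = d * (8 * d) ^ 2 := by
    simp only [W, WeierstrassCurve.Δ, WeierstrassCurve.b₂, WeierstrassCurve.b₄,
      WeierstrassCurve.b₆, WeierstrassCurve.b₈]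
    ring
  have hc₆ : W.c₆ = 0 := by
    simp [W, WeierstrassCurve.c₆, WeierstrassCurve.b₂, WeierstrassCurve.b₄, WeierstrassCurve.b₆]
  have h8 : 8 * d ≠ 0 := mul_ne_zero (by norm_num) hd
  have hΔ : W.Δ ≠ 0 := by
    rw [hW]
    exact mul_ne_zero hd (pow_ne_zero 2 h8)
  have hE : W.IsElliptic := ⟨hΔ.isUnit⟩
  refine ⟨⟨W, hE⟩, ?_, ?_⟩
  · have hrel : (W.j - 1728) * W.Δ = W.c₆ ^ 2 := j_mul_Δ ⟨W, hE⟩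
    rw [hc₆] at hrel
    simpa [hΔ, sub_eq_zero] using hrel
  · change sqrtField W.Δ = _
    rw [hW, sqrtField_mul_sq _ h8]

end SerreEntanglement

theorem mainTheorem9
    (K : IntermediateField ℚ SerreEntanglement.Qbar) (hK : Module.finrank ℚ K = 2) :
    -- infinitely many classes over the algebraic closure
    ((fun E => (⟦E⟧ : SerreEntanglement.GeometricClass)) ''
        SerreEntanglement.serreCurves K).Infinite ∧
    -- the entanglement occurs at level `4|Δ_E|` whenever the model has integral discriminant
    (∀ E ∈ SerreEntanglement.serreCurves K, ∀ D : ℤ, E.1.Δ = (D : ℚ) →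
      SerreEntanglement.HasWeilEntanglement E 2 (4 * D.natAbs) (Multiplicative (ZMod 2))) ∧
    -- the description by `j`-invariants
    (∃ d : ℤ, Squarefree d ∧ d ≠ 1 ∧ K = SerreEntanglement.sqrtField (d : ℚ) ∧
      (∀ E : SerreEntanglement.RatEllipticCurve, E.1.j ≠ 1728 →
        (E ∈ SerreEntanglement.serreCurves K ↔
          ∃ t : ℚ, t ≠ 0 ∧ E.1.j = (d : ℚ) * t ^ 2 + 1728)) ∧
      (∃ E ∈ SerreEntanglement.serreCurves K, E.1.j = 1728)) := by
  open SerreEntanglement in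
  obtain ⟨d, hd, hd1, hKd⟩ := exists_sqrtField_eq_of_finrank_eq_two hK
  refine ⟨infinite_image_serreCurves hK hKd, fun E hE D hD => ?_, d, hd, hd1, hKd,
    fun E hj => ?_, ?_⟩
  · exact hasWeilEntanglement_of_sqrtField_eq E (hE.2 ▸ hK) (by rw [hD])
  · rw [mem_serreCurves_iff hK, hKd, sqrtField_Δ_eq_iff_j E hj (hKd ▸ hK)]
  · obtain ⟨E, hj, hE⟩ := exists_j_eq_1728 (d := d) (by exact_mod_cast hd.ne_zero)
    exact ⟨E, (mem_serreCurves_iff hK E).mpr (hE.trans hKd.symm), hj⟩
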